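/- Let $0<\delta<\frac1{20}$, let $q_1,q_2,q_3$ be positive integers, and let $A,B$ be subsets of the ring $R=\mathbb Z/q_1\mathbb Z\times\mathbb Z/q_2\mathbb Z\times\mathbb Z/q_3\mathbb Z$ (with componentwise operations) such that $|A|>(q_1q_2q_3)^{1-\delta}$ and $|B|>(q_1q_2q_3)^{1-\delta}$. Then there are positive divisors $q_1'\mid q_1$, $q_2'\mid q_2$, $q_3'\mid q_3$ with $q_1'q_2'q_3'<(q_1q_2q_3)^{24\delta}$ such that $$\sum_{240}(AB-AB)\supseteq q_1'\mathbb Z/q_1\mathbb Z\times q_2'\mathbb Z/q_2\mathbb Z\times q_3'\mathbb Z/q_3\mathbb Z .$$ Here $AB=\{ab: a\in A,\ b\in B\}$, $AB-AB=\{x-y: x,y\in AB\}$, $\sum_k S=\{s_1+\dots+s_k: s_1,\dots,s_k\in S\}$, and $q_i'\mathbb Z/q_i\mathbb Z$ is the set of multiples of $q_i'$ in $\mathbb Z/q_i\mathbb Z$. -/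

import Mathlib

open scoped Pointwise

/-- The `k`-fold sum `∑_k S = S + ⋯ + S` (`k` summands) of a subset `S` of an additive
commutative monoid: all sums `s₁ + ⋯ + s_k` with every `s_i` in `S`. (The notation `k • S` is
avoided because it may also denote the dilate of `S` by `k`.) -/
def kFoldSum {R : Type*} [AddCommMonoid R] (k : ℕ) (S : Set R) : Set R :=
  {x | ∃ s : Fin k → R, (∀ i, s i ∈ S) ∧ ∑ i, s i = x}

/-- The subgroup `dℤ/qℤ` of `ℤ/qℤ`, as a set: the multiples of the residue class of `d`. -/
def multiplesMod (d q : ℕ) : Set (ZMod q) :=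
  {x | ∃ y : ZMod q, x = (d : ZMod q) * y}

/-! Pass to structured pieces: some coset of an ideal `I` maximises `|A ∩ (x + I)|^12 / |I|^11`.
Recentred at a point of `A`, that piece `A'` cannot concentrate on cosets of other ideals, and
comparison with the whole ring gives `|I| ≥ |A|^12 / |R|^11`. Likewise `B' ⊆ J`. Ideals are
principal, `I = (d)` and `J = (e)`.

For such pieces the bilinear sum `∑ ψ(ξab)` is at most `|A'||B'| N^(-5/12)` with `N = |(ξde)|`
(`IsRegularIn.norm_sum_sum_addChar_pow_le`). Its 120th power therefore saves `N^50`, and `∑_{η ≠ 0}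
|(η)|^(-50) < 1`, so Fourier inversion writes every element of `(de)` as a sum of 120 products
`a'b'` (`exists_sum_eq_of_norm_sum_addChar_le`). Each product is a sum of two elements of `AB - AB`,
hence 240. The index of `(de)` is at most the product of those of `I` and `J`, each below
`|R|^(12δ)`, hence `24δ`. -/

section Ideals

/-! ### Counting in ideals, and regular pieces of a set. -/

variable {R : Type*} [CommRing R]

/-- The elements of the ideal `I` that are annihilated by `c`. -/
def Ideal.annihilatedBy (I : Ideal R) (c : R) : Ideal R :=
  I ⊓ LinearMap.ker (LinearMap.mulLeft R c)

theorem Ideal.mem_annihilatedBy {I : Ideal R} {c x : R} :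
    x ∈ I.annihilatedBy c ↔ x ∈ I ∧ c * x = 0 := by
  simp [Ideal.annihilatedBy]

/-- Kernel and image of multiplication by `c` on `(d)`. -/
theorem card_annihilatedBy_mul_card_span (c d : R) :
    Nat.card ((Ideal.span {d}).annihilatedBy c) * Nat.card (Ideal.span {c * d}) =
      Nat.card (Ideal.span {d}) := by
  set f := (LinearMap.mulLeft R c).domRestrict (Ideal.span {d}) with hf
  have h := Submodule.card_eq_card_quotient_mul_card (LinearMap.ker f)
  rw [Nat.card_congr f.quotKerEquivRange.toEquiv] at h
  have hr : LinearMap.range f = Ideal.span {c * d} := by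
    ext x
    simp only [hf, LinearMap.mem_range, LinearMap.domRestrict_apply, LinearMap.mulLeft_apply,
      Subtype.exists, Ideal.mem_span_singleton']
    constructor
    · rintro ⟨_, ⟨a, rfl⟩, rfl⟩
      exact ⟨a, by ring⟩
    · rintro ⟨a, rfl⟩
      exact ⟨a * d, ⟨a, rfl⟩, by ring⟩
  have hk : Nat.card (LinearMap.ker f) = Nat.card ((Ideal.span {d}).annihilatedBy c) := by
    refine Nat.card_congr ⟨fun x => ⟨x.1.1, ?_⟩, fun x => ⟨⟨x.1, ?_⟩, ?_⟩, fun _ => rfl, fun _ => rfl⟩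
    · exact Ideal.mem_annihilatedBy.2 ⟨x.1.2, x.2⟩
    · exact (Ideal.mem_annihilatedBy.1 x.2).1
    · exact (Ideal.mem_annihilatedBy.1 x.2).2
  rw [hr, hk] at h
  exact h.symm

/-- Multiplication by `e` has a smaller kernel on `(d)` than on `R`; so indices of principal ideals
are submultiplicative. -/
theorem card_span_mul_card_span_le [Finite R] (d e : R) :
    Nat.card (Ideal.span {d}) * Nat.card (Ideal.span {e}) ≤
      Nat.card R * Nat.card (Ideal.span {e * d}) := by
  have h1 := card_annihilatedBy_mul_card_span e d
  have h2 := card_annihilatedBy_mul_card_span e (1 : R)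
  rw [mul_one, Ideal.span_singleton_one, Nat.card_congr Submodule.topEquiv.toEquiv] at h2
  have h3 : Nat.card ((Ideal.span {d}).annihilatedBy e) ≤
      Nat.card ((⊤ : Ideal R).annihilatedBy e) :=
    Nat.card_le_card_of_injective
      (fun x => ⟨x.1, Ideal.mem_annihilatedBy.2 ⟨trivial, (Ideal.mem_annihilatedBy.1 x.2).2⟩⟩)
      fun x y h => Subtype.ext (congrArg (fun z => z.1) h)
  rw [← h1, ← h2]
  calc _ = Nat.card ((Ideal.span {d}).annihilatedBy e) *
        (Nat.card (Ideal.span {e * d}) * Nat.card (Ideal.span {e})) := by ring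
    _ ≤ Nat.card ((⊤ : Ideal R).annihilatedBy e) *
        (Nat.card (Ideal.span {e * d}) * Nat.card (Ideal.span {e})) := by gcongr
    _ = _ := by ring

open Classical in
/-- A nonempty subset `A` of the ideal `I` such that the proportion of `A` in any coset of any
ideal `K` is at most `(|K| / |I|) ^ (11 / 12)`. -/
def IsRegularIn (I : Ideal R) (A : Finset R) : Prop :=
  A.Nonempty ∧ (∀ a ∈ A, a ∈ I) ∧ ∀ (K : Ideal R) (y : R),
    (A.filter fun a => a - y ∈ K).card ^ 12 * Nat.card I ^ 11 ≤ A.card ^ 12 * Nat.card K ^ 11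

open Classical in
theorem exists_isRegularIn_translate [Finite R] (A : Finset R) (hA : A.Nonempty) :
    ∃ (I : Ideal R) (x : R) (A' : Finset R), x ∈ A ∧ (∀ a ∈ A', a + x ∈ A) ∧ IsRegularIn I A' ∧
      A.card ^ 12 ≤ Nat.card I * Nat.card R ^ 11 := by
  have : Finite (Ideal R) := Finite.of_injective _ SetLike.coe_injective
  have pos : ∀ I : Ideal R, 0 < Nat.card I := fun I => Nat.card_pos
  obtain ⟨⟨I, x⟩, hmax⟩ := Finite.exists_max (fun p : Ideal R × R =>
    ((A.filter fun a => a - p.2 ∈ p.1).card ^ 12 / Nat.card p.1 ^ 11 : ℚ))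
  have key : ∀ (K : Ideal R) (y : R), (A.filter fun a => a - y ∈ K).card ^ 12 * Nat.card I ^ 11 ≤
      (A.filter fun a => a - x ∈ I).card ^ 12 * Nat.card K ^ 11 := by
    intro K y
    have h := hmax (K, y)
    have p1 : (0 : ℚ) < (Nat.card K : ℚ) ^ 11 := by have := pos K; positivity
    have p2 : (0 : ℚ) < (Nat.card I : ℚ) ^ 11 := by have := pos I; positivity
    simp only at h
    rw [div_le_div_iff₀ p1 p2] at h
    exact_mod_cast h
  set F := A.filter fun a => a - x ∈ I with hF
  have ht := key ⊤ 0
  rw [Finset.filter_true_of_mem (by simp), Nat.card_congr Submodule.topEquiv.toEquiv] at ht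
  have hFne : F.Nonempty := by
    rw [← Finset.card_pos]
    by_contra h0
    have h0 : F.card = 0 := by omega
    rw [h0] at ht
    have : 0 < A.card ^ 12 * Nat.card I ^ 11 := by
      have := pos I; have := hA.card_pos; positivity
    simp at ht
    rcases ht with h | h
    · exact hA.ne_empty h
    · have := pos I; omega
  -- The maximising centre `x` need not lie in `A`; recentring at `a₀` gives a translation by an
  -- element of `A`.
  obtain ⟨a₀, ha₀⟩ := hFne
  have hmem : ∀ a ∈ F, a ∈ A ∧ a - x ∈ I := fun a ha => Finset.mem_filter.1 ha
  have hinj : Function.Injective (fun a : R => a - a₀) := sub_left_injective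
  have hcard : (F.image (fun a => a - a₀)).card = F.card := Finset.card_image_of_injective _ hinj
  have hsub : ∀ b ∈ F.image (fun a => a - a₀), b ∈ I := by
    intro b hb
    obtain ⟨a, ha, rfl⟩ := Finset.mem_image.1 hb
    have := I.sub_mem (hmem a ha).2 (hmem a₀ ha₀).2
    simpa using this
  refine ⟨I, a₀, F.image (fun a => a - a₀), (hmem a₀ ha₀).1, ?_, ⟨?_, hsub, ?_⟩, ?_⟩
  · intro b hb
    obtain ⟨a, ha, rfl⟩ := Finset.mem_image.1 hb
    simpa using (hmem a ha).1
  · exact ⟨_, Finset.mem_image_of_mem _ ha₀⟩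
  · intro K y
    rw [hcard]
    rw [Finset.filter_image, Finset.card_image_of_injective _ hinj]
    refine le_trans ?_ (key K (a₀ + y))
    gcongr
    intro a ha
    rw [Finset.mem_filter] at ha ⊢
    exact ⟨(hmem a ha.1).1, by rw [← sub_sub]; exact ha.2⟩
  · have hle : F.card ≤ Nat.card I := by
      rw [← hcard, ← Set.ncard_coe_finset]
      exact Set.ncard_le_ncard hsub (Set.toFinite _)
    have : A.card ^ 12 * Nat.card I ^ 11 ≤ (Nat.card I * Nat.card R ^ 11) * Nat.card I ^ 11 := by
      calc _ ≤ F.card ^ 12 * Nat.card R ^ 11 := ht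
        _ ≤ Nat.card I ^ 12 * Nat.card R ^ 11 := by gcongr
        _ = _ := by ring
    exact Nat.le_of_mul_le_mul_right this (by have := pos I; positivity)

end Ideals

/-! ### Bilinear character sums and the circle method. -/

section CharacterSums

theorem AddChar.map_finset_sum {G M ι : Type*} [AddCommMonoid G] [CommMonoid M]
    (χ : AddChar G M) (s : Finset ι) (f : ι → G) : χ (∑ i ∈ s, f i) = ∏ i ∈ s, χ (f i) :=
  map_prod χ.toMonoidHom (fun i => Multiplicative.ofAdd (f i)) s

variable {R : Type*} [CommRing R] [Fintype R] {ψ : AddChar R ℂ}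

open Classical in
theorem sum_ideal_addChar (hψ : ψ.IsPrimitive) (c d : R) :
    ∑ u : Ideal.span {d}, ψ (c * u) =
      if c * d = 0 then (Nat.card (Ideal.span {d}) : ℂ) else 0 := by
  split_ifs with h
  · rw [Nat.card_eq_fintype_card, ← Finset.card_univ, Finset.card_eq_sum_ones, Nat.cast_sum]
    refine Finset.sum_congr rfl fun u _ => ?_
    obtain ⟨a, ha⟩ := Ideal.mem_span_singleton'.1 u.2
    rw [← ha, show c * (a * d) = a * (c * d) by ring, h]
    simp
  · set χ : AddChar (Ideal.span {d}) ℂ :=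
      (ψ.mulShift c).compAddMonoidHom (Ideal.span {d}).toAddSubgroup.subtype with hχ
    have hval : ∀ u : Ideal.span {d}, χ u = ψ (c * u) := fun u => rfl
    have hne : χ ≠ 1 := by
      obtain ⟨r, hr⟩ := AddChar.ne_one_iff.1 (hψ h)
      refine AddChar.ne_one_iff.2
        ⟨⟨r * d, Ideal.mem_span_singleton'.2 ⟨r, rfl⟩⟩, ?_⟩
      rw [hval]
      rw [AddChar.mulShift_apply] at hr
      convert hr using 2
      ring
    rw [← AddChar.sum_eq_zero_of_ne_one hne]
    rfl

-- Cauchy–Schwarz in `a`, then completion: the inner square `G` is invariant under `K`, so the sum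
-- over `A` is at most `X / |K|` times the sum over all of `(d)`, which orthogonality evaluates.
open Classical in
theorem norm_sum_sum_addChar_sq_le (hψ : ψ.IsPrimitive) (ξ d e : R) (A B : Finset R)
    (hA : ∀ a ∈ A, a ∈ Ideal.span {d}) (hB : ∀ b ∈ B, b ∈ Ideal.span {e}) {X Y : ℕ}
    (hX : ∀ y, (A.filter fun a => a - y ∈ (Ideal.span {d}).annihilatedBy (ξ * e)).card ≤ X)
    (hY : ∀ y, (B.filter fun b => b - y ∈ (Ideal.span {e}).annihilatedBy (ξ * d)).card ≤ Y) :
    Nat.card ((Ideal.span {d}).annihilatedBy (ξ * e)) *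
      ‖∑ a ∈ A, ∑ b ∈ B, ψ (ξ * (a * b))‖ ^ 2 ≤
      A.card * X * (Nat.card (Ideal.span {d}) * (B.card * Y)) := by
  set I := Ideal.span {d}
  set K := I.annihilatedBy (ξ * e)
  set G : R → ℝ := fun u => ‖∑ b ∈ B, ψ (ξ * (u * b))‖ ^ 2 with hG
  have hG0 : ∀ u, 0 ≤ G u := fun u => by positivity
  have cauchy : ‖∑ a ∈ A, ∑ b ∈ B, ψ (ξ * (a * b))‖ ^ 2 ≤ A.card * ∑ a ∈ A, G a :=
    (pow_le_pow_left₀ (norm_nonneg _) (norm_sum_le _ _) 2).trans sq_sum_le_card_mul_sum_sq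
  have shift : ∀ a, ∀ k ∈ K, G (a + k) = G a := by
    intro a k hk
    simp only [hG]
    congr 2
    refine Finset.sum_congr rfl fun b hb => ?_
    obtain ⟨r, rfl⟩ := Ideal.mem_span_singleton'.1 (hB b hb)
    have := (Ideal.mem_annihilatedBy.1 hk).2
    congr 1
    linear_combination r * this
  have average : Nat.card K * ∑ a ∈ A, G a ≤ X * ∑ u : I, G u := by
    calc (Nat.card K : ℝ) * ∑ a ∈ A, G a = ∑ a ∈ A, ∑ k : K, G (a + k) := by
          rw [Finset.mul_sum]
          refine Finset.sum_congr rfl fun a _ => ?_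
          rw [Finset.sum_congr rfl fun (k : K) _ => shift a k k.2]
          simp [Nat.card_eq_fintype_card]
      _ = ∑ a ∈ A, ∑ u : I, if a - u ∈ K then G u else 0 := by
          refine Finset.sum_congr rfl fun a ha => ?_
          rw [← Finset.sum_filter]
          refine Finset.sum_bij' (fun k _ => ⟨a + k, I.add_mem (hA a ha)
            (Ideal.mem_annihilatedBy.1 k.2).1⟩)
            (fun u hu => ⟨u - a, by
              rw [← neg_sub]; exact K.neg_mem (Finset.mem_filter.1 hu).2⟩) ?_ ?_ ?_ ?_ ?_
          · intro k _
            simp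
          · intro u hu
            simp
          · intro k _
            simp
          · intro u _
            simp
          · intro k _
            rfl
      _ = ∑ u : I, ((A.filter fun a : R => a - (u : R) ∈ K).card : ℝ) * G u := by
          rw [Finset.sum_comm]
          refine Finset.sum_congr rfl fun u _ => ?_
          rw [← Finset.sum_filter, Finset.sum_const, nsmul_eq_mul]
      _ ≤ ∑ u : I, (X : ℝ) * G u := by
          gcongr with u _
          exact hX u
      _ = _ := by rw [Finset.mul_sum]
  have second : ∑ u : I, G u ≤ Nat.card I * (B.card * Y) := by
    have hexp : ((∑ u : I, G u : ℝ) : ℂ) = ((Nat.card I *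
        ∑ b ∈ B, (B.filter fun b' => b' - b ∈ (Ideal.span {e}).annihilatedBy (ξ * d)).card : ℕ) :
          ℂ) := by
      calc ((∑ u : I, G u : ℝ) : ℂ)
          = ∑ u : I, ∑ b ∈ B, ∑ b' ∈ B, ψ (ξ * (b' - b) * u) := by
            rw [Complex.ofReal_sum]
            refine Finset.sum_congr rfl fun u _ => ?_
            simp only [hG]
            rw [Complex.ofReal_pow, ← Complex.conj_mul', map_sum, Finset.sum_mul_sum]
            refine Finset.sum_congr rfl fun b _ => Finset.sum_congr rfl fun b' _ => ?_
            rw [← AddChar.map_neg_eq_conj, ← AddChar.map_add_eq_mul]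
            congr 1
            ring
        _ = ∑ b ∈ B, ∑ b' ∈ B, ∑ u : I, ψ (ξ * (b' - b) * u) := by
            rw [Finset.sum_comm]
            exact Finset.sum_congr rfl fun b _ => Finset.sum_comm
        _ = ∑ b ∈ B, ∑ b' ∈ B,
            if b' - b ∈ (Ideal.span {e}).annihilatedBy (ξ * d) then (Nat.card I : ℂ) else 0 := by
            refine Finset.sum_congr rfl fun b hb => Finset.sum_congr rfl fun b' hb' => ?_
            rw [sum_ideal_addChar hψ]
            refine if_congr ?_ rfl rfl
            rw [Ideal.mem_annihilatedBy, and_iff_right (Ideal.sub_mem _ (hB b' hb') (hB b hb)),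
              mul_right_comm]
        _ = _ := by
            push_cast
            rw [Finset.mul_sum]
            refine Finset.sum_congr rfl fun b _ => ?_
            rw [← Finset.sum_filter, Finset.sum_const, nsmul_eq_mul, mul_comm]
    have hexp' := hexp
    rw [← Complex.ofReal_natCast, Complex.ofReal_inj] at hexp'
    rw [hexp']
    have : ∑ b ∈ B, (B.filter fun b' =>
        b' - b ∈ (Ideal.span {e}).annihilatedBy (ξ * d)).card ≤ B.card * Y := by
      rw [← smul_eq_mul]
      exact Finset.sum_le_card_nsmul _ _ _ fun b _ => hY b
    exact_mod_cast Nat.mul_le_mul_left _ this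
  calc _ ≤ (Nat.card K : ℝ) * (A.card * ∑ a ∈ A, G a) := by gcongr
    _ = A.card * (Nat.card K * ∑ a ∈ A, G a) := by ring
    _ ≤ A.card * (X * (Nat.card I * (B.card * Y))) := by
        refine mul_le_mul_of_nonneg_left (average.trans ?_) (Nat.cast_nonneg _)
        gcongr
    _ = _ := by ring

open Classical in
theorem IsRegularIn.exists_card_filter_le {d c : R} {A : Finset R}
    (hA : IsRegularIn (Ideal.span {d}) A) :
    ∃ X : ℕ, (∀ y, (A.filter fun a => a - y ∈ (Ideal.span {d}).annihilatedBy c).card ≤ X) ∧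
      X ^ 12 * Nat.card (Ideal.span {c * d}) ^ 11 ≤ A.card ^ 12 := by
  obtain ⟨y, hy⟩ := Finite.exists_max fun y =>
    (A.filter fun a => a - y ∈ (Ideal.span {d}).annihilatedBy c).card
  refine ⟨_, hy, ?_⟩
  have h := hA.2.2 ((Ideal.span {d}).annihilatedBy c) y
  rw [← card_annihilatedBy_mul_card_span c d] at h
  have hpos : 0 < Nat.card ((Ideal.span {d}).annihilatedBy c) ^ 11 := pow_pos Nat.card_pos _
  refine Nat.le_of_mul_le_mul_right ?_ hpos
  calc _ = _ := by ring
    _ ≤ _ := h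

/-- Regularity saves `N^(11/12)` in each of `X` and `Y`, while completion costs `|I| / |K| = N`: the
squared sum gains `N^(10/12)`. -/
theorem IsRegularIn.norm_sum_sum_addChar_pow_le (hψ : ψ.IsPrimitive) (ξ d e : R)
    {A B : Finset R} (hA : IsRegularIn (Ideal.span {d}) A) (hB : IsRegularIn (Ideal.span {e}) B) :
    ‖∑ a ∈ A, ∑ b ∈ B, ψ (ξ * (a * b))‖ ^ 24 * Nat.card (Ideal.span {ξ * (d * e)}) ^ 10 ≤
      ((A.card * B.card : ℕ) : ℝ) ^ 24 := by
  obtain ⟨X, hX, hX'⟩ := hA.exists_card_filter_le (c := ξ * e)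
  obtain ⟨Y, hY, hY'⟩ := hB.exists_card_filter_le (c := ξ * d)
  have h := norm_sum_sum_addChar_sq_le hψ ξ d e A B hA.2.1 hB.2.1 hX hY
  have hI := card_annihilatedBy_mul_card_span (ξ * e) d
  rw [show ξ * e * d = ξ * (d * e) by ring] at hX' hI
  rw [show ξ * d * e = ξ * (d * e) by ring] at hY'
  rw [← hI] at h
  set S := ‖∑ a ∈ A, ∑ b ∈ B, ψ (ξ * (a * b))‖
  set N := Nat.card (Ideal.span {ξ * (d * e)})
  have hN : (0 : ℝ) < N := Nat.cast_pos.2 Nat.card_pos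
  have hK : (0 : ℝ) < Nat.card ((Ideal.span {d}).annihilatedBy (ξ * e)) :=
    Nat.cast_pos.2 Nat.card_pos
  have h1 : S ^ 2 ≤ A.card * X * (N * (B.card * Y)) := by
    refine le_of_mul_le_mul_left (h.trans (le_of_eq ?_)) hK
    push_cast
    ring
  have hX2 : (X : ℝ) ^ 12 * (N : ℝ) ^ 11 ≤ (A.card : ℝ) ^ 12 := by exact_mod_cast hX'
  have hY2 : (Y : ℝ) ^ 12 * (N : ℝ) ^ 11 ≤ (B.card : ℝ) ^ 12 := by exact_mod_cast hY'
  have hN12 : (0 : ℝ) < (N : ℝ) ^ 12 := by positivity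
  refine le_of_mul_le_mul_right ?_ hN12
  calc S ^ 24 * (N : ℝ) ^ 10 * (N : ℝ) ^ 12 = (S ^ 2) ^ 12 * (N : ℝ) ^ 22 := by ring
    _ ≤ (A.card * X * (N * (B.card * Y))) ^ 12 * (N : ℝ) ^ 22 := by gcongr
    _ = (A.card : ℝ) ^ 12 * (B.card : ℝ) ^ 12 * (N : ℝ) ^ 12 *
        (((X : ℝ) ^ 12 * (N : ℝ) ^ 11) * ((Y : ℝ) ^ 12 * (N : ℝ) ^ 11)) := by ring
    _ ≤ (A.card : ℝ) ^ 12 * (B.card : ℝ) ^ 12 * (N : ℝ) ^ 12 *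
        ((A.card : ℝ) ^ 12 * (B.card : ℝ) ^ 12) := by gcongr
    _ = _ := by push_cast; ring

open Classical in
/-- If the character sums `∑ a, ψ (ξ * f a)` are small enough, every multiple of `m` is a sum of
`k` values of `f`. -/
theorem exists_sum_eq_of_norm_sum_addChar_le (hψ : ψ.IsPrimitive) {α : Type*} [Fintype α]
    [Nonempty α] (f : α → R) (m : R) (hf : ∀ a, f a ∈ Ideal.span {m}) (k : ℕ) (w : R → ℝ)
    (hw : ∀ η, 0 ≤ w η) (hsum : ∑ η ∈ Finset.univ.erase 0, w η < 1)
    (hS : ∀ ξ, ‖∑ a, ψ (ξ * f a)‖ ^ k ≤ (Fintype.card α : ℝ) ^ k * w (ξ * m))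
    {t : R} (ht : t ∈ Ideal.span {m}) : ∃ s : Fin k → α, ∑ i, f (s i) = t := by
  by_contra! hne
  set S : R → ℂ := fun ξ => ∑ a, ψ (ξ * f a) with hSdef
  -- This sum is `|R|` times the number of representations of `t`.
  have hzero : ∑ ξ, ψ (ξ * -t) * S ξ ^ k = 0 := by
    calc ∑ ξ, ψ (ξ * -t) * S ξ ^ k = ∑ ξ, ∑ s : Fin k → α, ψ (ξ * (∑ i, f (s i) - t)) := by
          refine Finset.sum_congr rfl fun ξ _ => ?_
          simp only [hSdef]
          rw [Fintype.sum_pow, Finset.mul_sum]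
          refine Finset.sum_congr rfl fun s _ => ?_
          rw [show ξ * (∑ i, f (s i) - t) = ξ * -t + ∑ i, ξ * f (s i) by
            rw [← Finset.mul_sum]; ring, AddChar.map_add_eq_mul, AddChar.map_finset_sum]
      _ = 0 := by
          rw [Finset.sum_comm]
          refine Finset.sum_eq_zero fun s _ => ?_
          rw [AddChar.sum_mulShift _ hψ, if_neg (sub_ne_zero.2 (hne s))]
          simp
  set Z := Finset.univ.filter fun ξ : R => ξ * m = 0 with hZ
  have hZpos : 0 < (Z.card : ℝ) := by
    rw [Nat.cast_pos, Finset.card_pos]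
    exact ⟨0, by simp [hZ]⟩
  have hcard : (0 : ℝ) < (Fintype.card α : ℝ) ^ k := by
    have : 0 < Fintype.card α := Fintype.card_pos
    positivity
  have kill : ∀ ξ x, ξ * m = 0 → x ∈ Ideal.span {m} → ξ * x = 0 := by
    intro ξ x h hx
    obtain ⟨r, rfl⟩ := Ideal.mem_span_singleton'.1 hx
    linear_combination r * h
  rw [← Finset.sum_filter_add_sum_filter_not _ (fun ξ : R => ξ * m = 0)] at hzero
  have main : ∑ ξ ∈ Z, ψ (ξ * -t) * S ξ ^ k = Z.card * (Fintype.card α : ℂ) ^ k := by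
    rw [← nsmul_eq_mul, ← Finset.sum_const]
    refine Finset.sum_congr rfl fun ξ hξ => ?_
    have h0 := (Finset.mem_filter.1 hξ).2
    simp only [hSdef]
    rw [kill ξ _ h0 (neg_mem ht), AddChar.map_zero_eq_one, one_mul,
      Finset.sum_congr rfl fun a _ => by rw [kill ξ _ h0 (hf a), AddChar.map_zero_eq_one]]
    simp
  rw [main] at hzero
  -- A nonempty fibre of `ξ ↦ ξ * m` is a coset of `Z`, so each `η` weighs no more than the main
  -- term.
  have fiber : ∀ η, ((Finset.univ.filter fun ξ : R => ξ * m = η).card : ℝ) ≤ Z.card := by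
    intro η
    rw [Nat.cast_le]
    rcases (Finset.univ.filter fun ξ : R => ξ * m = η).eq_empty_or_nonempty with h | ⟨ξ₀, h⟩
    · simp [h]
    · refine Finset.card_le_card_of_injOn (fun ξ => ξ - ξ₀) (fun ξ hξ => ?_)
        sub_left_injective.injOn
      simp only [Finset.coe_filter, Finset.mem_univ, true_and, Set.mem_ofPred_eq,
        Finset.mem_filter] at h hξ
      simp [hZ, sub_mul, h, hξ]
  have rest : ‖∑ ξ ∈ Finset.univ.filter (fun ξ : R => ¬ ξ * m = 0), ψ (ξ * -t) * S ξ ^ k‖ <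
      Z.card * (Fintype.card α : ℝ) ^ k := by
    calc _ ≤ ∑ ξ ∈ Finset.univ.filter (fun ξ : R => ¬ ξ * m = 0),
          (Fintype.card α : ℝ) ^ k * w (ξ * m) := by
          refine norm_sum_le_of_le _ fun ξ _ => ?_
          rw [norm_mul, AddChar.norm_apply, one_mul, norm_pow]
          exact hS ξ
      _ = (Fintype.card α : ℝ) ^ k * ∑ η ∈ Finset.univ.erase (0 : R),
          ∑ ξ ∈ (Finset.univ.filter fun ξ : R => ¬ ξ * m = 0) with ξ * m = η, w (ξ * m) := by
          rw [← Finset.mul_sum, Finset.sum_fiberwise_of_maps_to (g := fun ξ => ξ * m)]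
          intro ξ hξ
          simpa using hξ
      _ ≤ (Fintype.card α : ℝ) ^ k * ∑ η ∈ Finset.univ.erase (0 : R), Z.card * w η := by
          gcongr with η hη
          rw [Finset.sum_congr rfl fun ξ hξ => by rw [(Finset.mem_filter.1 hξ).2],
            Finset.sum_const, nsmul_eq_mul]
          refine mul_le_mul_of_nonneg_right (le_trans ?_ (fiber η)) (hw η)
          exact_mod_cast Finset.card_le_card (Finset.filter_subset_filter _ (Finset.subset_univ _))
      _ = (Z.card * (Fintype.card α : ℝ) ^ k) * ∑ η ∈ Finset.univ.erase (0 : R), w η := by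
          rw [← Finset.mul_sum]; ring
      _ < (Z.card * (Fintype.card α : ℝ) ^ k) * 1 := by gcongr
      _ = _ := mul_one _
  rw [eq_neg_of_add_eq_zero_right hzero, norm_neg] at rest
  simp at rest

end CharacterSums

/-! ### Ideals and primitive characters in product rings. -/

section ProductRings

variable {R S : Type*} [CommRing R] [CommRing S]

theorem span_singleton_prod (x : R) (y : S) :
    Ideal.span {(x, y)} = Ideal.prod (Ideal.span {x}) (Ideal.span {y}) := by
  rw [← Ideal.span_prod (by simp), Set.singleton_prod_singleton]

theorem card_span_singleton_prod (x : R) (y : S) :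
    Nat.card (Ideal.span {(x, y)}) = Nat.card (Ideal.span {x}) * Nat.card (Ideal.span {y}) := by
  rw [span_singleton_prod, ← Nat.card_prod]
  exact Nat.card_congr (Equiv.Set.prod (Ideal.span {x} : Set R) (Ideal.span {y} : Set S))

theorem exists_isPrimitive_prod {ψ : AddChar R ℂ} {χ : AddChar S ℂ} (hψ : ψ.IsPrimitive)
    (hχ : χ.IsPrimitive) : ∃ φ : AddChar (R × S) ℂ, φ.IsPrimitive := by
  refine ⟨ψ.compAddMonoidHom (AddMonoidHom.fst R S) * χ.compAddMonoidHom (AddMonoidHom.snd R S),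
    fun a ha => AddChar.ne_one_iff.2 ?_⟩
  by_cases h1 : a.1 = 0
  · have h2 : a.2 ≠ 0 := fun h2 => ha (Prod.ext h1 h2)
    obtain ⟨y, hy⟩ := AddChar.ne_one_iff.1 (hχ h2)
    exact ⟨(0, y), by simpa using hy⟩
  · obtain ⟨x, hx⟩ := AddChar.ne_one_iff.1 (hψ h1)
    exact ⟨(x, 0), by simpa using hx⟩

theorem sum_inv_card_span_pow_prod [Fintype R] [Fintype S] (k : ℕ) :
    ∑ η : R × S, ((Nat.card (Ideal.span {η}) : ℝ) ^ k)⁻¹ =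
      (∑ x : R, ((Nat.card (Ideal.span {x}) : ℝ) ^ k)⁻¹) *
        ∑ y : S, ((Nat.card (Ideal.span {y}) : ℝ) ^ k)⁻¹ := by
  rw [Fintype.sum_prod_type, Finset.sum_mul_sum]
  refine Finset.sum_congr rfl fun x _ => Finset.sum_congr rfl fun y _ => ?_
  rw [card_span_singleton_prod]
  push_cast
  rw [mul_pow, mul_inv]

end ProductRings

/-! ### Principal ideals of `ℤ/qℤ`. -/

section ZModIdeals

theorem card_span_zmod {q : ℕ} (x : ZMod q) : Nat.card (Ideal.span {x}) = addOrderOf x := by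
  rw [← Nat.card_zmultiples]
  refine Nat.card_congr (Equiv.setCongr ?_)
  ext y
  simp only [SetLike.mem_coe, Ideal.mem_span_singleton', AddSubgroup.mem_zmultiples_iff,
    zsmul_eq_mul]
  constructor
  · rintro ⟨a, rfl⟩
    obtain ⟨n, rfl⟩ := ZMod.intCast_surjective a
    exact ⟨n, rfl⟩
  · rintro ⟨n, rfl⟩
    exact ⟨n, rfl⟩

theorem card_span_zmod_mul_gcd {q : ℕ} (hq : q ≠ 0) (x : ZMod q) :
    Nat.card (Ideal.span {x}) * q.gcd x.val = q := by
  have : NeZero q := ⟨hq⟩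
  rw [card_span_zmod, ← ZMod.natCast_zmod_val x, ZMod.addOrderOf_coe _ hq,
    ZMod.natCast_zmod_val]
  exact Nat.div_mul_cancel (Nat.gcd_dvd_left _ _)

theorem multiplesMod_gcd_subset {q : ℕ} (hq : q ≠ 0) (x : ZMod q) {z : ZMod q}
    (hz : z ∈ multiplesMod (q.gcd x.val) q) : z ∈ Ideal.span {x} := by
  have : NeZero q := ⟨hq⟩
  obtain ⟨y, rfl⟩ := hz
  refine Ideal.mem_span_singleton'.2 ⟨(q.gcdB x.val : ZMod q) * y, ?_⟩
  have h := congrArg (Int.cast : ℤ → ZMod q) (Nat.gcd_eq_gcd_ab q x.val)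
  push_cast at h
  rw [h, ZMod.natCast_self, ZMod.natCast_zmod_val]
  ring

instance isPrincipalIdealRing_zmod (q : ℕ) : IsPrincipalIdealRing (ZMod q) :=
  IsPrincipalIdealRing.of_surjective (Int.castRingHom (ZMod q)) ZMod.intCast_surjective

theorem sum_Icc_inv_mul_pred_le_one (q : ℕ) :
    ∑ N ∈ Finset.Icc 2 q, ((N : ℝ) * (N - 1))⁻¹ ≤ 1 := by
  have h : ∀ n : ℕ, ∑ N ∈ Finset.Icc 2 (n + 1), ((N : ℝ) * (N - 1))⁻¹ = 1 - ((n : ℝ) + 1)⁻¹ := by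
    intro n
    induction n with
    | zero => simp
    | succ n ih =>
      rw [Finset.sum_Icc_succ_top (by omega), ih]
      push_cast
      have : (n : ℝ) + 1 ≠ 0 := by positivity
      have : (n : ℝ) + 1 + 1 ≠ 0 := by positivity
      rw [add_sub_cancel_right]
      field_simp
      ring
  rcases q with _ | n
  · simp
  · rw [h]
    have : 0 ≤ ((n : ℝ) + 1)⁻¹ := by positivity
    linarith

/-- Grouping by additive order gives `∑_{N ∣ q} φ(N) / N^50`. The bound `9 / 8` suffices because its
cube is below 2. -/
theorem sum_inv_card_span_pow_zmod_le (q : ℕ) [NeZero q] :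
    ∑ x : ZMod q, ((Nat.card (Ideal.span {x}) : ℝ) ^ 50)⁻¹ ≤ 9 / 8 := by
  have hmaps : ∀ x ∈ (Finset.univ : Finset (ZMod q)), addOrderOf x ∈ q.divisors := by
    intro x _
    refine Nat.mem_divisors.2 ⟨?_, NeZero.ne q⟩
    have := addOrderOf_dvd_natCard x
    rwa [Nat.card_zmod] at this
  simp only [card_span_zmod]
  rw [← Finset.sum_fiberwise_of_maps_to hmaps]
  have hterm : ∀ N ∈ q.divisors, ∑ x : ZMod q with addOrderOf x = N,
      ((addOrderOf x : ℝ) ^ 50)⁻¹ = N.totient * ((N : ℝ) ^ 50)⁻¹ := by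
    intro N hN
    rw [Finset.sum_congr rfl fun x hx => by rw [(Finset.mem_filter.1 hx).2], Finset.sum_const,
      nsmul_eq_mul, IsAddCyclic.card_addOrderOf_eq_totient]
    rw [ZMod.card]
    exact Nat.dvd_of_mem_divisors hN
  rw [Finset.sum_congr rfl hterm]
  have hq : 1 ≤ q := NeZero.one_le
  calc ∑ N ∈ q.divisors, (N.totient : ℝ) * ((N : ℝ) ^ 50)⁻¹
      ≤ ∑ N ∈ Finset.Icc 1 q, (N.totient : ℝ) * ((N : ℝ) ^ 50)⁻¹ := by
        refine Finset.sum_le_sum_of_subset_of_nonneg (fun N hN => ?_) fun _ _ _ => by positivity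
        exact Finset.mem_Icc.2 ⟨Nat.pos_of_mem_divisors hN, Nat.divisor_le hN⟩
    _ = 1 + ∑ N ∈ Finset.Icc 2 q, (N.totient : ℝ) * ((N : ℝ) ^ 50)⁻¹ := by
        rw [← Finset.add_sum_Ioc_eq_sum_Icc hq]
        simp [show Finset.Ioc 1 q = Finset.Icc 2 q from rfl]
    _ ≤ 1 + ∑ N ∈ Finset.Icc 2 q, 1 / 8 * ((N : ℝ) * (N - 1))⁻¹ := by
        refine add_le_add_right (Finset.sum_le_sum fun N hN => ?_) 1
        have h2 : (2 : ℝ) ≤ N := by exact_mod_cast (Finset.mem_Icc.1 hN).1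
        have ht : (N.totient : ℝ) ≤ N := by exact_mod_cast Nat.totient_le N
        have hpos : (0 : ℝ) < (N : ℝ) * (N - 1) := by
          have : (0 : ℝ) < N - 1 := by linarith
          positivity
        rw [← div_eq_mul_inv, ← div_eq_mul_inv, div_le_div_iff₀ (by positivity) hpos]
        calc (N.totient : ℝ) * (N * (N - 1)) ≤ N * (N * N) := by
              gcongr
              linarith
          _ = (1 / 8 * 2 ^ 3) * (N : ℝ) ^ 3 := by ring
          _ ≤ 1 / 8 * (N : ℝ) ^ 47 * (N : ℝ) ^ 3 := by
              gcongr
              calc (2 : ℝ) ^ 3 ≤ 2 ^ 47 := by norm_num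
                _ ≤ (N : ℝ) ^ 47 := by gcongr
          _ = 1 / 8 * (N : ℝ) ^ 50 := by ring
    _ ≤ 9 / 8 := by
        rw [← Finset.mul_sum]
        linarith [sum_Icc_inv_mul_pred_le_one q]

end ZModIdeals

/-! ### The sumset theorem for finite principal ideal rings. -/

section Sumset

open Classical in
/-- In a finite principal ideal ring, dense sets `A`, `B` satisfy that `∑_240 (AB - AB)` contains
a large principal ideal. -/
theorem exists_span_subset_kFoldSum {R : Type*} [CommRing R] [Fintype R] [IsPrincipalIdealRing R]
    {ψ : AddChar R ℂ} (hψ : ψ.IsPrimitive)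
    (hsum : ∑ η : R, ((Nat.card (Ideal.span {η}) : ℝ) ^ 50)⁻¹ < 2)
    (A B : Finset R) (hA : A.Nonempty) (hB : B.Nonempty) :
    ∃ m : R, A.card ^ 12 * B.card ^ 12 ≤ Nat.card R ^ 23 * Nat.card (Ideal.span {m}) ∧
      (Ideal.span {m} : Set R) ⊆
        kFoldSum 240 ((A : Set R) * (B : Set R) - (A : Set R) * (B : Set R)) := by
  obtain ⟨I, x, A', hx, hAx, hrA, hcA⟩ := exists_isRegularIn_translate A hA
  obtain ⟨J, y, B', hy, hBy, hrB, hcB⟩ := exists_isRegularIn_translate B hB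
  obtain ⟨d, rfl⟩ : ∃ d, I = Ideal.span {d} := (IsPrincipalIdealRing.principal I).principal
  obtain ⟨e, rfl⟩ : ∃ e, J = Ideal.span {e} := (IsPrincipalIdealRing.principal J).principal
  refine ⟨e * d, ?_, fun t ht => ?_⟩
  · calc A.card ^ 12 * B.card ^ 12
        ≤ (Nat.card (Ideal.span {d}) * Nat.card R ^ 11) *
          (Nat.card (Ideal.span {e}) * Nat.card R ^ 11) := by gcongr
      _ = Nat.card R ^ 22 * (Nat.card (Ideal.span {d}) * Nat.card (Ideal.span {e})) := by ring
      _ ≤ Nat.card R ^ 22 * (Nat.card R * Nat.card (Ideal.span {e * d})) := by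
          exact Nat.mul_le_mul_left _ (card_span_mul_card_span_le d e)
      _ = _ := by ring
  have : Nonempty (A' × B') :=
    ⟨⟨⟨_, hrA.1.choose_spec⟩, ⟨_, hrB.1.choose_spec⟩⟩⟩
  have hdouble : ∀ ξ, ∑ p : A' × B', ψ (ξ * (p.1.1 * p.2.1)) =
      ∑ a ∈ A', ∑ b ∈ B', ψ (ξ * (a * b)) := by
    intro ξ
    rw [Fintype.sum_prod_type, ← Finset.sum_coe_sort A']
    exact Finset.sum_congr rfl fun a _ => Finset.sum_coe_sort B' fun b => ψ (ξ * (a * b))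
  obtain ⟨s, hs⟩ := exists_sum_eq_of_norm_sum_addChar_le hψ
    (fun p : A' × B' => (p.1 : R) * p.2) (e * d) (fun p => by
      obtain ⟨u, hu⟩ := Ideal.mem_span_singleton'.1 (hrA.2.1 _ p.1.2)
      obtain ⟨v, hv⟩ := Ideal.mem_span_singleton'.1 (hrB.2.1 _ p.2.2)
      refine Ideal.mem_span_singleton'.2 ⟨u * v, ?_⟩
      rw [← hu, ← hv]
      ring) 120
    (fun η => ((Nat.card (Ideal.span {η}) : ℝ) ^ 50)⁻¹) (fun η => by positivity) (by
      -- The term `η = 0` equals 1, so a total below 2 leaves less than 1.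
      have h := Finset.add_sum_erase Finset.univ
        (fun η : R => ((Nat.card (Ideal.span {η}) : ℝ) ^ 50)⁻¹) (Finset.mem_univ 0)
      simp only [Ideal.span_singleton_zero] at h
      simp at h hsum ⊢
      linarith) (fun ξ => by
      rw [hdouble]
      have h := hrA.norm_sum_sum_addChar_pow_le hψ ξ d e hrB
      have hN : (0 : ℝ) < Nat.card (Ideal.span {ξ * (e * d)}) := Nat.cast_pos.2 Nat.card_pos
      rw [mul_comm d e] at h
      rw [← div_eq_mul_inv, le_div_iff₀ (by positivity), Fintype.card_prod, Fintype.card_coe,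
        Fintype.card_coe]
      -- Fifth power of the 24th-power bound: `120 = 5 · 24`, `50 = 5 · 10`.
      calc _ = _ := by ring
        _ ≤ _ := pow_le_pow_left₀ (by positivity) h 5
        _ = _ := by ring) ht
  set AB := (A : Set R) * (B : Set R)
  have hAB : ∀ a ∈ A, ∀ b ∈ B, a * b ∈ AB := fun a ha b hb => Set.mul_mem_mul ha hb
  -- `ab = [(a+x)(b+y) - (a+x)y] + [xy - x(b+y)]`: the first brackets fill the indices below 120,
  -- the second the rest.
  refine ⟨fun i => if h : (i : ℕ) < 120
    then ((s ⟨i, h⟩).1 + x) * ((s ⟨i, h⟩).2 + y) - ((s ⟨i, h⟩).1 + x) * y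
    else x * y - x * ((s ⟨i - 120, by omega⟩).2 + y), fun i => ?_, ?_⟩
  · dsimp only
    split_ifs with h
    · exact Set.sub_mem_sub (hAB _ (hAx _ (s _).1.2) _ (hBy _ (s _).2.2))
        (hAB _ (hAx _ (s _).1.2) _ hy)
    · exact Set.sub_mem_sub (hAB _ hx _ hy) (hAB _ hx _ (hBy _ (s _).2.2))
  · rw [Fin.sum_univ_add (a := 120) (b := 120), ← Finset.sum_add_distrib, ← hs]
    refine Finset.sum_congr rfl fun i _ => ?_
    simp
    ring

end Sumset

/-! ### Specialisation to three cyclic factors. -/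

theorem lemma3p2 (δ : ℝ) (hδ_pos : 0 < δ) (hδ_lt : δ < 1 / 20)
    (q₁ q₂ q₃ : ℕ) (hq₁ : 0 < q₁) (hq₂ : 0 < q₂) (hq₃ : 0 < q₃)
    (A B : Set (ZMod q₁ × ZMod q₂ × ZMod q₃))
    (hA : ((q₁ : ℝ) * (q₂ : ℝ) * (q₃ : ℝ)) ^ (1 - δ) < (A.ncard : ℝ))
    (hB : ((q₁ : ℝ) * (q₂ : ℝ) * (q₃ : ℝ)) ^ (1 - δ) < (B.ncard : ℝ)) :
    ∃ q₁' q₂' q₃' : ℕ, q₁' ∣ q₁ ∧ q₂' ∣ q₂ ∧ q₃' ∣ q₃ ∧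
      (q₁' : ℝ) * (q₂' : ℝ) * (q₃' : ℝ) < ((q₁ : ℝ) * (q₂ : ℝ) * (q₃ : ℝ)) ^ (24 * δ) ∧
      multiplesMod q₁' q₁ ×ˢ multiplesMod q₂' q₂ ×ˢ multiplesMod q₃' q₃ ⊆
        kFoldSum 240 (A * B - A * B) := by
  classical
  have : NeZero q₁ := ⟨hq₁.ne'⟩
  have : NeZero q₂ := ⟨hq₂.ne'⟩
  have : NeZero q₃ := ⟨hq₃.ne'⟩
  obtain ⟨φ, hφ⟩ := exists_isPrimitive_prod (ZMod.isPrimitive_stdAddChar q₂)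
    (ZMod.isPrimitive_stdAddChar q₃)
  obtain ⟨ψ, hψ⟩ := exists_isPrimitive_prod (ZMod.isPrimitive_stdAddChar q₁) hφ
  have hsum : ∑ η : ZMod q₁ × ZMod q₂ × ZMod q₃, ((Nat.card (Ideal.span {η}) : ℝ) ^ 50)⁻¹ < 2 := by
    rw [sum_inv_card_span_pow_prod, sum_inv_card_span_pow_prod]
    calc _ ≤ (9 / 8 : ℝ) * (9 / 8 * (9 / 8)) := by
          gcongr <;> exact sum_inv_card_span_pow_zmod_le _
      _ < 2 := by norm_num
  obtain ⟨A, rfl⟩ := A.toFinite.exists_finset_coe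
  obtain ⟨B, rfl⟩ := B.toFinite.exists_finset_coe
  rw [Set.ncard_coe_finset] at hA hB
  set Q : ℝ := (q₁ : ℝ) * (q₂ : ℝ) * (q₃ : ℝ) with hQ
  have hQpos : 0 < Q := by
    have : (0 : ℝ) < q₁ := by exact_mod_cast hq₁
    have : (0 : ℝ) < q₂ := by exact_mod_cast hq₂
    have : (0 : ℝ) < q₃ := by exact_mod_cast hq₃
    positivity
  have hp : 0 < Q ^ (1 - δ) := Real.rpow_pos_of_pos hQpos _
  have hAne : A.Nonempty := Finset.card_pos.1 (by exact_mod_cast hp.trans hA)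
  have hBne : B.Nonempty := Finset.card_pos.1 (by exact_mod_cast hp.trans hB)
  obtain ⟨m, hcard, hsub⟩ := exists_span_subset_kFoldSum hψ hsum A B hAne hBne
  obtain ⟨m₁, m₂, m₃⟩ := m
  refine ⟨q₁.gcd m₁.val, q₂.gcd m₂.val, q₃.gcd m₃.val, Nat.gcd_dvd_left _ _, Nat.gcd_dvd_left _ _,
    Nat.gcd_dvd_left _ _, ?_, fun z hz => hsub ?_⟩
  · have h₁ := card_span_zmod_mul_gcd hq₁.ne' m₁
    have h₂ := card_span_zmod_mul_gcd hq₂.ne' m₂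
    have h₃ := card_span_zmod_mul_gcd hq₃.ne' m₃
    set M := Nat.card (Ideal.span {(m₁, m₂, m₃)}) with hM
    rw [card_span_singleton_prod, card_span_singleton_prod] at hM
    set Q' : ℝ := (q₁.gcd m₁.val : ℝ) * (q₂.gcd m₂.val : ℝ) * (q₃.gcd m₃.val : ℝ) with hQ'
    have hQM : M * Q' = Q := by
      have h₁' : (Nat.card (Ideal.span {m₁}) : ℝ) * q₁.gcd m₁.val = q₁ := by exact_mod_cast h₁
      have h₂' : (Nat.card (Ideal.span {m₂}) : ℝ) * q₂.gcd m₂.val = q₂ := by exact_mod_cast h₂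
      have h₃' : (Nat.card (Ideal.span {m₃}) : ℝ) * q₃.gcd m₃.val = q₃ := by exact_mod_cast h₃
      rw [hM, hQ', hQ, ← h₁', ← h₂', ← h₃']
      push_cast
      ring
    have hQ'pos : 0 < Q' :=
      pos_of_mul_pos_right (hQM.symm ▸ hQpos) (Nat.cast_nonneg M)
    have hR : (Nat.card (ZMod q₁ × ZMod q₂ × ZMod q₃) : ℝ) = Q := by
      simp [hQ, mul_assoc]
    have hcard' : (A.card : ℝ) ^ 12 * (B.card : ℝ) ^ 12 ≤ Q ^ 23 * M := by
      rw [← hR]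
      exact_mod_cast hcard
    -- That is, `M > Q^(1 - 24δ)`, so the index `Q' = Q / M` is below `Q^(24δ)`.
    have hlt : Q ^ (24 - 24 * δ) < Q ^ 23 * M := by
      calc Q ^ (24 - 24 * δ) = (Q ^ (1 - δ)) ^ 12 * (Q ^ (1 - δ)) ^ 12 := by
            rw [← pow_add, ← Real.rpow_mul_natCast hQpos.le]
            congr 1
            norm_num
            ring
        _ < (A.card : ℝ) ^ 12 * (B.card : ℝ) ^ 12 := by gcongr
        _ ≤ _ := hcard'
    have h24 : Q ^ (24 - 24 * δ) * Q ^ (24 * δ) = Q ^ 24 := by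
      rw [← Real.rpow_add hQpos, sub_add_cancel]
      exact_mod_cast Real.rpow_natCast Q 24
    refine lt_of_mul_lt_mul_left ?_ (Real.rpow_pos_of_pos hQpos (24 - 24 * δ)).le
    calc _ < Q ^ 23 * M * Q' := by gcongr
      _ = Q ^ 24 := by rw [mul_assoc, hQM]; ring
      _ = _ := h24.symm
  · rw [SetLike.mem_coe, span_singleton_prod, span_singleton_prod]
    exact ⟨multiplesMod_gcd_subset hq₁.ne' m₁ hz.1, multiplesMod_gcd_subset hq₂.ne' m₂ hz.2.1,
      multiplesMod_gcd_subset hq₃.ne' m₃ hz.2.2⟩
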